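/- Let $M$ be an $n$-dimensional $C^\infty$ manifold and $L$ a Finsler metric function on $M$: $L>0$ and $C^\infty$ on nonzero tangent vectors, positively homogeneous of degree one in $y$, with $g_{ij}=\dot\partial_i\dot\partial_j E$, $E=\tfrac12L^2$, positive definite. (Here $\partial_i=\partial/\partial x^i$ and $\dot\partial_i=\partial/\partial y^i$ in the coordinates $(x,y)$ that a chart of $M$ induces on $TM$, and repeated indices are summed.) Let $\sigma$ be a smooth function and $\beta=b_i(x)y^i$ a smooth $1$-form on $M$ such that the $\beta$-conformal change $$\overline L(x,y)=e^{\sigma(x)}L(x,y)+\beta(x,y)$$ is again a Finsler metric function. To $L$ are associated - the canonical spray $S^i=g^{il}\bigl(y^k\partial_k\dot\partial_lE-\partial_lE\bigr)$ (geodesics satisfy $\ddot x^i+S^i(x,\dot x)=0$); - the Cartan nonlinear connection $N^i_j=\tfrac12\dot\partial_jS^i$, with $\delta_k=\partial_k-N^r_k\dot\partial_r$; - the Cartan connection coefficients $\Gamma^i_{jk}=\tfrac12g^{il}(\delta_jg_{lk}+\delta_kg_{lj}-\delta_lg_{jk})$; and $\overline S^i,\overline N^i_j,\overline\Gamma^i_{jk}$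 are the same objects of $\overline L$. Put $D^i_{jk}=\overline\Gamma^i_{jk}-\Gamma^i_{jk}$, $D^r_{0j}=D^r_{ij}y^i$, $D^r_{00}=D^r_{ij}y^iy^j$. In every chart, at every $x$ and every $y\neq0$, the nonlinear connections satisfy $N^r_j=y^k\Gamma^r_{jk}$ and $\overline N^r_j=y^k\overline\Gamma^r_{jk}$, and $$\overline S^r=S^r+D^r_{00},\qquad \overline N^r_j=N^r_j+D^r_{0j},$$ where $$D^r_{00}=2Le^{-\sigma}F^r_0+\frac{L}{\overline L}\bigl(E_{00}-2Le^{-\sigma}F_{\beta0}\bigr)L^r-L^2\sigma^r+\frac{L}{\overline L}\bigl(2Le^{\sigma}\sigma_0+L^2\sigma_\beta\bigr)L^r,$$ $$D^r_{0j}=L\,G^r{}_j+\frac{L}{\overline L}\bigl(G_j-L\,G_{\beta j}\bigr)L^r,$$ with $$G_{ij}=e^{-\sigma}F_{ij}-\tfrac12L_{ijr}D^r_{00}+\tfrac12(\sigma_0L_{ij}-\mu_{ij}),\qquad G_j=E_{0j}-\tfrac12e^{\sigma}L_{jr}D^r_{00}+\tfrac12e^{\sigma}(\sigma_0L_j+\sigma_jL),$$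 in which $D^r_{00}$ stands for the explicit expression above. Notation: $L_i=\dot\partial_iL$, $L_{ij}=\dot\partial_jL_i$, $L_{ijk}=\dot\partial_kL_{ij}$, $L^i=y^i/L$, $b^i=g^{ij}b_j$; $b_{i|j}=\partial_jb_i-b_r\Gamma^r_{ij}$, $E_{ij}=\tfrac12(b_{i|j}+b_{j|i})$, $F_{ij}=\tfrac12(b_{i|j}-b_{j|i})$, $E_{0j}=E_{ij}y^i$, $E_{00}=E_{ij}y^iy^j$, $F_{i0}=F_{ij}y^j$, $F^r_0=g^{ir}F_{i0}$, $F_{\beta0}=F_{i0}b^i$; $\sigma_i=\partial_i\sigma$, $\sigma^r=g^{ri}\sigma_i$, $\sigma_0=\sigma_iy^i$, $\sigma_\beta=\sigma_ib^i$, $\mu_{ij}=\sigma_iL_j-\sigma_jL_i$; $G^i{}_j=g^{ir}G_{rj}$, $G_{\beta j}=b^iG_{ij}$. -/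

import Mathlib

open scoped Manifold ContDiff

noncomputable section

namespace FinslerCoord

/-- The coordinate space `ℝⁿ` on which manifolds are modelled. -/
abbrev Coord (n : ℕ) : Type := EuclideanSpace ℝ (Fin n)

/-! ### Finsler geometry in one coordinate system

A function on (part of) the tangent bundle is written in the induced coordinates as
`f : Coord n → Coord n → ℝ`, `(x, y) ↦ f x y`. -/

section Local

variable {n : ℕ}

/-- `∂ᵢ f`: partial derivative with respect to the position coordinate `xⁱ`. -/
def dx (i : Fin n) (f : Coord n → Coord n → ℝ) (x y : Coord n) : ℝ :=
  fderiv ℝ (fun z => f z y) x (EuclideanSpace.single i 1)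

/-- `∂̇ᵢ f`: partial derivative with respect to the fibre coordinate `yⁱ`. -/
def dy (i : Fin n) (f : Coord n → Coord n → ℝ) (x y : Coord n) : ℝ :=
  fderiv ℝ (fun w => f x w) y (EuclideanSpace.single i 1)

/-- The energy `E = L² / 2`. -/
def energy (L : Coord n → Coord n → ℝ) (x y : Coord n) : ℝ := L x y ^ 2 / 2

/-- The fundamental tensor `g_{ij} = ∂̇ᵢ ∂̇ⱼ E`. -/
def g (L : Coord n → Coord n → ℝ) (i j : Fin n) (x y : Coord n) : ℝ :=
  dy i (dy j (energy L)) x y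

/-- The matrix of the fundamental tensor. -/
def gMatrix (L : Coord n → Coord n → ℝ) (x y : Coord n) : Matrix (Fin n) (Fin n) ℝ :=
  Matrix.of fun i j => g L i j x y

/-- The inverse `g^{ij}` of the fundamental tensor. -/
def gInv (L : Coord n → Coord n → ℝ) (i j : Fin n) (x y : Coord n) : ℝ :=
  (gMatrix L x y)⁻¹ i j

/-- `L_i = ∂̇ᵢ L`. -/
def L1 (L : Coord n → Coord n → ℝ) (i : Fin n) (x y : Coord n) : ℝ := dy i L x y

/-- `L_{ij} = ∂̇ⱼ L_i`. -/
def L2 (L : Coord n → Coord n → ℝ) (i j : Fin n) (x y : Coord n) : ℝ := dy j (L1 L i) x y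

/-- `L_{ijk} = ∂̇ₖ L_{ij}`. -/
def L3 (L : Coord n → Coord n → ℝ) (i j k : Fin n) (x y : Coord n) : ℝ := dy k (L2 L i j) x y

/-- `L^i = y^i / L`. -/
def LUp (L : Coord n → Coord n → ℝ) (i : Fin n) (x y : Coord n) : ℝ := y i / L x y

/-- The canonical spray `S^i = g^{il} (y^k ∂ₖ ∂̇ₗ E - ∂ₗ E)`, so that geodesics are the solutions of
`ẍ^i + S^i(x, ẋ) = 0`. -/
def spray (L : Coord n → Coord n → ℝ) (i : Fin n) (x y : Coord n) : ℝ :=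
  ∑ l, gInv L i l x y * ((∑ k, y k * dx k (dy l (energy L)) x y) - dx l (energy L) x y)

/-- The Cartan (canonical, or Barthel) nonlinear connection `N^i_j = ½ ∂̇ⱼ S^i`. -/
def cartanN (L : Coord n → Coord n → ℝ) (i j : Fin n) (x y : Coord n) : ℝ :=
  dy j (spray L i) x y / 2

/-- The horizontal derivative `δₖ f = ∂ₖ f - N^r_k ∂̇ᵣ f`. -/
def delta (L : Coord n → Coord n → ℝ) (k : Fin n) (f : Coord n → Coord n → ℝ)
    (x y : Coord n) : ℝ :=
  dx k f x y - ∑ r, cartanN L r k x y * dy r f x y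

/-- The (horizontal) coefficients of the Cartan connection,
`Γ^i_{jk} = ½ g^{il} (δⱼ g_{lk} + δₖ g_{lj} - δₗ g_{jk})`. -/
def Gam (L : Coord n → Coord n → ℝ) (i j k : Fin n) (x y : Coord n) : ℝ :=
  (1 / 2) * ∑ l, gInv L i l x y *
    (delta L j (g L l k) x y + delta L k (g L l j) x y - delta L l (g L j k) x y)

/-- The horizontal covariant derivative `X_{i|j} = δⱼ X_i - X_r Γ^r_{ij}` of a covector field. -/
def hcov (L : Coord n → Coord n → ℝ) (X : Fin n → Coord n → Coord n → ℝ) (i j : Fin n)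
    (x y : Coord n) : ℝ :=
  delta L j (X i) x y - ∑ r, X r x y * Gam L r i j x y

/-- The difference tensor `D^i_{jk} = Γ̄^i_{jk} - Γ^i_{jk}` of the two Cartan connections. -/
def diffTensor (L Lbar : Coord n → Coord n → ℝ) (i j k : Fin n) (x y : Coord n) : ℝ :=
  Gam Lbar i j k x y - Gam L i j k x y

/-- The contraction `D^r_{00} = D^r_{ij} y^i y^j`. -/
def diff00 (L Lbar : Coord n → Coord n → ℝ) (r : Fin n) (x y : Coord n) : ℝ :=
  ∑ i, ∑ j, diffTensor L Lbar r i j x y * y i * y j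

/-- The contraction `D^r_{0j} = D^r_{ij} y^i`. -/
def diff0 (L Lbar : Coord n → Coord n → ℝ) (r j : Fin n) (x y : Coord n) : ℝ :=
  ∑ i, diffTensor L Lbar r i j x y * y i

/-! ### The explicit expressions

Here `s` is the local expression of the conformal exponent and `b i` are the components of the
one-form; indices are raised with the fundamental tensor of `L`, and the index `0` denotes
contraction with `y`. -/

/-- `E_{ij} = ½ (b_{i|j} + b_{j|i})`. -/
def Esym (L : Coord n → Coord n → ℝ) (b : Fin n → Coord n → ℝ) (i j : Fin n)
    (x y : Coord n) : ℝ :=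
  (hcov L (fun k x _ => b k x) i j x y + hcov L (fun k x _ => b k x) j i x y) / 2

/-- `F_{ij} = ½ (b_{i|j} - b_{j|i})`. -/
def Fanti (L : Coord n → Coord n → ℝ) (b : Fin n → Coord n → ℝ) (i j : Fin n)
    (x y : Coord n) : ℝ :=
  (hcov L (fun k x _ => b k x) i j x y - hcov L (fun k x _ => b k x) j i x y) / 2

/-- `E_{0j} = E_{ij} y^i`. -/
def E0 (L : Coord n → Coord n → ℝ) (b : Fin n → Coord n → ℝ) (j : Fin n) (x y : Coord n) : ℝ :=
  ∑ i, Esym L b i j x y * y i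

/-- `E_{00} = E_{ij} y^i y^j`. -/
def E00 (L : Coord n → Coord n → ℝ) (b : Fin n → Coord n → ℝ) (x y : Coord n) : ℝ :=
  ∑ i, ∑ j, Esym L b i j x y * y i * y j

/-- `F_{i0} = F_{ij} y^j`. -/
def F0 (L : Coord n → Coord n → ℝ) (b : Fin n → Coord n → ℝ) (i : Fin n) (x y : Coord n) : ℝ :=
  ∑ j, Fanti L b i j x y * y j

/-- `b^i = g^{ij} b_j`. -/
def bUp (L : Coord n → Coord n → ℝ) (b : Fin n → Coord n → ℝ) (i : Fin n) (x y : Coord n) : ℝ :=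
  ∑ j, gInv L i j x y * b j x

/-- `σ_i = ∂σ / ∂x^i`. -/
def sig (s : Coord n → ℝ) (i : Fin n) (x : Coord n) : ℝ :=
  fderiv ℝ s x (EuclideanSpace.single i 1)

/-- `σ^r = g^{ri} σ_i`. -/
def sigUp (L : Coord n → Coord n → ℝ) (s : Coord n → ℝ) (r : Fin n) (x y : Coord n) : ℝ :=
  ∑ i, gInv L r i x y * sig s i x

/-- `σ_0 = σ_j y^j`. -/
def sig0 (s : Coord n → ℝ) (x y : Coord n) : ℝ := ∑ j, sig s j x * y j

/-- `σ_β = σ_i b^i`. -/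
def sigBeta (L : Coord n → Coord n → ℝ) (s : Coord n → ℝ) (b : Fin n → Coord n → ℝ)
    (x y : Coord n) : ℝ :=
  ∑ i, sig s i x * bUp L b i x y

/-- `F^r_0 = g^{ir} F_{i0}`. -/
def F0Up (L : Coord n → Coord n → ℝ) (b : Fin n → Coord n → ℝ) (r : Fin n) (x y : Coord n) : ℝ :=
  ∑ i, gInv L i r x y * F0 L b i x y

/-- `F_{β0} = F_{i0} b^i`. -/
def FBeta0 (L : Coord n → Coord n → ℝ) (b : Fin n → Coord n → ℝ) (x y : Coord n) : ℝ :=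
  ∑ i, F0 L b i x y * bUp L b i x y

/-- `μ_{ij} = σ_i L_j - σ_j L_i`. -/
def mu (L : Coord n → Coord n → ℝ) (s : Coord n → ℝ) (i j : Fin n) (x y : Coord n) : ℝ :=
  sig s i x * L1 L j x y - sig s j x * L1 L i x y

/-- The explicit expression
`2 L e^{-σ} F^r_0 + (L/L̄)(E_{00} - 2 L e^{-σ} F_{β0}) L^r - L² σ^r
  + (L/L̄)(2 L e^σ σ_0 + L² σ_β) L^r`. -/
def D00 (L Lbar : Coord n → Coord n → ℝ) (s : Coord n → ℝ) (b : Fin n → Coord n → ℝ)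
    (r : Fin n) (x y : Coord n) : ℝ :=
  2 * L x y * Real.exp (-s x) * F0Up L b r x y
    + L x y / Lbar x y * (E00 L b x y - 2 * L x y * Real.exp (-s x) * FBeta0 L b x y) * LUp L r x y
    - L x y ^ 2 * sigUp L s r x y
    + L x y / Lbar x y
      * (2 * L x y * Real.exp (s x) * sig0 s x y + L x y ^ 2 * sigBeta L s b x y) * LUp L r x y

/-- `G_{ij} = e^{-σ} F_{ij} - ½ L_{ijr} D^r_{00} + ½ (σ_0 L_{ij} - μ_{ij})`, with `D^r_{00}` the
explicit expression above. -/
def G2 (L Lbar : Coord n → Coord n → ℝ) (s : Coord n → ℝ) (b : Fin n → Coord n → ℝ)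
    (i j : Fin n) (x y : Coord n) : ℝ :=
  Real.exp (-s x) * Fanti L b i j x y
    - (1 / 2) * ∑ r, L3 L i j r x y * D00 L Lbar s b r x y
    + (1 / 2) * (sig0 s x y * L2 L i j x y - mu L s i j x y)

/-- `G_j = E_{0j} - ½ e^σ L_{jr} D^r_{00} + ½ e^σ (σ_0 L_j + σ_j L)`, with `D^r_{00}` the explicit
expression above. -/
def G1 (L Lbar : Coord n → Coord n → ℝ) (s : Coord n → ℝ) (b : Fin n → Coord n → ℝ)
    (j : Fin n) (x y : Coord n) : ℝ :=
  E0 L b j x y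
    - (1 / 2) * Real.exp (s x) * ∑ r, L2 L j r x y * D00 L Lbar s b r x y
    + (1 / 2) * Real.exp (s x) * (sig0 s x y * L1 L j x y + sig s j x * L x y)

/-- `G^i_j = g^{ir} G_{rj}`. -/
def G2Up (L Lbar : Coord n → Coord n → ℝ) (s : Coord n → ℝ) (b : Fin n → Coord n → ℝ)
    (i j : Fin n) (x y : Coord n) : ℝ :=
  ∑ r, gInv L i r x y * G2 L Lbar s b r j x y

/-- `G_{βj} = b^i G_{ij}`. -/
def G2Beta (L Lbar : Coord n → Coord n → ℝ) (s : Coord n → ℝ) (b : Fin n → Coord n → ℝ)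
    (j : Fin n) (x y : Coord n) : ℝ :=
  ∑ i, bUp L b i x y * G2 L Lbar s b i j x y

/-- The explicit expression `L G^i_j + (L/L̄)(G_j - L G_{βj}) L^i`. -/
def D0 (L Lbar : Coord n → Coord n → ℝ) (s : Coord n → ℝ) (b : Fin n → Coord n → ℝ)
    (i j : Fin n) (x y : Coord n) : ℝ :=
  L x y * G2Up L Lbar s b i j x y
    + L x y / Lbar x y * (G1 L Lbar s b j x y - L x y * G2Beta L Lbar s b j x y) * LUp L i x y

end Local

/-! ### Finsler metrics on manifolds -/

section Manifold

variable {n : ℕ} {M : Type*} [TopologicalSpace M] [ChartedSpace (Coord n) M]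

/-- The tangent vector at the point with coordinates `x` whose components in the chart `φ`
are `y`, i.e. `y^i ∂/∂x^i`. -/
def tangentVec (φ : OpenPartialHomeomorph M (Coord n)) (x y : Coord n) :
    TangentSpace (𝓡 n) (φ.symm x) :=
  mfderiv (𝓡 n) (𝓡 n) φ.symm x y

/-- The expression `L(x, y)` of a function on the tangent bundle in the coordinates induced by the
chart `φ`. -/
def coordRep (φ : OpenPartialHomeomorph M (Coord n)) (L : TangentBundle (𝓡 n) M → ℝ)
    (x y : Coord n) : ℝ :=
  L ⟨φ.symm x, tangentVec φ x y⟩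

/-- The components `b_i(x)` of a one-form in the chart `φ`. -/
def formComp (φ : OpenPartialHomeomorph M (Coord n))
    (β : ∀ p : M, TangentSpace (𝓡 n) p →L[ℝ] ℝ) (i : Fin n) (x : Coord n) : ℝ :=
  β (φ.symm x) (tangentVec φ x (EuclideanSpace.single i 1))

/-- A one-form is smooth if its components in every chart of the smooth structure are. -/
def IsSmoothOneForm (β : ∀ p : M, TangentSpace (𝓡 n) p →L[ℝ] ℝ) : Prop :=
  ∀ φ ∈ IsManifold.maximalAtlas (𝓡 n) ∞ M, ∀ i : Fin n,
    ContDiffOn ℝ ∞ (formComp φ β i) φ.target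

/-- A Finsler metric function: positive and smooth off the zero section, positively homogeneous of
degree one in `y`, with positive definite fundamental tensor. -/
structure IsFinslerMetric (L : TangentBundle (𝓡 n) M → ℝ) : Prop where
  pos : ∀ (p : M) (v : TangentSpace (𝓡 n) p), v ≠ 0 → 0 < L ⟨p, v⟩
  homogeneous : ∀ (p : M) (v : TangentSpace (𝓡 n) p) (c : ℝ), 0 < c →
    L ⟨p, c • v⟩ = c * L ⟨p, v⟩
  smooth : ∀ φ ∈ IsManifold.maximalAtlas (𝓡 n) ∞ M,
    ContDiffOn ℝ ∞ (fun q : Coord n × Coord n => coordRep φ L q.1 q.2)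
      (φ.target ×ˢ {y : Coord n | y ≠ 0})
  posDef : ∀ φ ∈ IsManifold.maximalAtlas (𝓡 n) ∞ M, ∀ x ∈ φ.target, ∀ y : Coord n, y ≠ 0 →
    (gMatrix (coordRep φ L) x y).PosDef

/-- The `β`-conformal change `L̄ = e^σ L + β`. -/
def betaConformalChange (σ : M → ℝ) (β : ∀ p : M, TangentSpace (𝓡 n) p →L[ℝ] ℝ)
    (L : TangentBundle (𝓡 n) M → ℝ) (v : TangentBundle (𝓡 n) M) : ℝ :=
  Real.exp (σ v.proj) * L v + β v.proj v.2

end Manifold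

end FinslerCoord

end

/-! The change acts simply on derivatives in `y`: since `β` is linear in `y`, `L̄_{ij} = e^σ L_{ij}`
and `L̄_i = e^σ L_i + b_i`. Moreover a vector `X` is determined by the contractions `L_{ir} X^r` and
`L̄_r X^r`: from `g_{ij} = L L_{ij} + L_i L_j`, the first fixes `X` up to a multiple of `y`, and
`L̄_r y^r = L̄ ≠ 0` fixes the multiple. The solution is explicit (`eq_of_contract`), and both
formulas of the theorem are instances of it.

For the spray, the geodesic equation splits into `L_r S^r = y^k ∂_k L` (`L1_spray`) and `L_{lr} S^r
= y^k ∂_k L_l - ∂_l L` (`L2_spray`). Comparing these with their counterparts for `L̄` gives both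
contractions of `S̄ - S` (`L2_diff`, `L1_diff`), hence `D00`.

For the nonlinear connection, the contraction with `L_{ir}` comes from differentiating the one for
the sprays in `y^j` (`L2_diffN`), and the contraction with `L̄_r` from `L_r N^r_j = ∂_j L`, valid
for both metrics (`L1_diffN`). This yields `D0`.

The Cartan coefficients enter only through `y^k Γ^r_{jk} = N^r_j` and `y^j N^r_j = S^r` (`y_Gam`,
`y_cartanN`), which identify the contracted difference tensors with `S̄ - S` and `N̄ - N`. -/

noncomputable section

namespace FinslerCoord

/-! ### Calculus of partial derivatives in induced coordinates -/

section Calculus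

variable {n : ℕ}

/-- Smoothness on `U` of a function given in induced coordinates. -/
def SmoothIn (U : Set (Coord n × Coord n)) (f : Coord n → Coord n → ℝ) : Prop :=
  ContDiffOn ℝ ∞ (fun q : Coord n × Coord n => f q.1 q.2) U

namespace SmoothIn

variable {U : Set (Coord n × Coord n)} {f h : Coord n → Coord n → ℝ} {x y : Coord n}

theorem add (hf : SmoothIn U f) (hh : SmoothIn U h) :
    SmoothIn U (fun x y => f x y + h x y) := ContDiffOn.add hf hh

theorem sub (hf : SmoothIn U f) (hh : SmoothIn U h) :
    SmoothIn U (fun x y => f x y - h x y) := ContDiffOn.sub hf hh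

theorem mul (hf : SmoothIn U f) (hh : SmoothIn U h) :
    SmoothIn U (fun x y => f x y * h x y) := ContDiffOn.mul hf hh

theorem const (c : ℝ) : SmoothIn U (fun _ _ => c) := contDiffOn_const

theorem sum {ι : Type*} {s : Finset ι} {f : ι → Coord n → Coord n → ℝ}
    (hf : ∀ i ∈ s, SmoothIn U (f i)) : SmoothIn U (fun x y => ∑ i ∈ s, f i x y) :=
  ContDiffOn.sum hf

theorem prod {ι : Type*} {s : Finset ι} {f : ι → Coord n → Coord n → ℝ}
    (hf : ∀ i ∈ s, SmoothIn U (f i)) : SmoothIn U (fun x y => ∏ i ∈ s, f i x y) :=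
  contDiffOn_prod hf

theorem inv (hf : SmoothIn U f) (h0 : ∀ q ∈ U, f q.1 q.2 ≠ 0) :
    SmoothIn U (fun x y => (f x y)⁻¹) := ContDiffOn.inv hf h0

theorem coord (i : Fin n) : SmoothIn U (fun _ y => y i) := by
  unfold SmoothIn; fun_prop

theorem of_base {T : Set (Coord n)} {s : Coord n → ℝ} (hs : ContDiffOn ℝ ∞ s T)
    (hU : U ⊆ T ×ˢ Set.univ) : SmoothIn U (fun x _ => s x) :=
  hs.comp contDiffOn_fst fun _ hq => (hU hq).1

theorem contDiffAt (hU : IsOpen U) (hf : SmoothIn U f) (hp : (x, y) ∈ U) :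
    ContDiffAt ℝ ∞ (fun q : Coord n × Coord n => f q.1 q.2) (x, y) :=
  ContDiffOn.contDiffAt hf (hU.mem_nhds hp)

theorem differentiableAt (hU : IsOpen U) (hf : SmoothIn U f) (hp : (x, y) ∈ U) :
    DifferentiableAt ℝ (fun q : Coord n × Coord n => f q.1 q.2) (x, y) :=
  (hf.contDiffAt hU hp).differentiableAt (by simp)

theorem differentiableAt_left (hU : IsOpen U) (hf : SmoothIn U f) (hp : (x, y) ∈ U) :
    DifferentiableAt ℝ (fun z => f z y) x :=
  (hf.differentiableAt hU hp).comp x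
    (f := fun z => (z, y)) (differentiableAt_id.prodMk (differentiableAt_const y))

theorem differentiableAt_right (hU : IsOpen U) (hf : SmoothIn U f) (hp : (x, y) ∈ U) :
    DifferentiableAt ℝ (fun w => f x w) y :=
  (hf.differentiableAt hU hp).comp y
    (f := fun w => (x, w)) ((differentiableAt_const x).prodMk differentiableAt_id)

theorem dx_eq_fderiv (hU : IsOpen U) (hf : SmoothIn U f) (hp : (x, y) ∈ U) (i : Fin n) :
    dx i f x y = fderiv ℝ (fun q : Coord n × Coord n => f q.1 q.2) (x, y)
      (EuclideanSpace.single i 1, 0) := by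
  have h := (hf.differentiableAt hU hp).hasFDerivAt.comp x
    (f := fun z => (z, y)) ((hasFDerivAt_id x).prodMk (hasFDerivAt_const y x))
  have h' : HasFDerivAt (fun z => f z y) _ x := h
  rw [dx, h'.fderiv]; simp

theorem dy_eq_fderiv (hU : IsOpen U) (hf : SmoothIn U f) (hp : (x, y) ∈ U) (i : Fin n) :
    dy i f x y = fderiv ℝ (fun q : Coord n × Coord n => f q.1 q.2) (x, y)
      (0, EuclideanSpace.single i 1) := by
  have h := (hf.differentiableAt hU hp).hasFDerivAt.comp y
    (f := fun w => (x, w)) ((hasFDerivAt_const x y).prodMk (hasFDerivAt_id y))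
  have h' : HasFDerivAt (fun w => f x w) _ y := h
  rw [dy, h'.fderiv]; simp

theorem congr (hf : SmoothIn U f) (hfh : ∀ q ∈ U, h q.1 q.2 = f q.1 q.2) : SmoothIn U h :=
  ContDiffOn.congr hf hfh

theorem fderiv_apply (hU : IsOpen U) (hf : SmoothIn U f) (v : Coord n × Coord n) :
    SmoothIn U (fun x y =>
      fderiv ℝ (fun q : Coord n × Coord n => f q.1 q.2) (x, y) v) :=
  (ContDiffOn.fderiv_of_isOpen hf hU (m := ∞) (by simp)).clm_apply contDiffOn_const

theorem dx (hU : IsOpen U) (hf : SmoothIn U f) (i : Fin n) : SmoothIn U (dx i f) :=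
  (hf.fderiv_apply hU _).congr fun _ hq => hf.dx_eq_fderiv hU hq i

theorem dy (hU : IsOpen U) (hf : SmoothIn U f) (i : Fin n) : SmoothIn U (dy i f) :=
  (hf.fderiv_apply hU _).congr fun _ hq => hf.dy_eq_fderiv hU hq i

end SmoothIn

variable {U : Set (Coord n × Coord n)} {f h : Coord n → Coord n → ℝ} {x y : Coord n}

theorem dx_congr (hU : IsOpen U) (hp : (x, y) ∈ U) (hfh : ∀ x y, (x, y) ∈ U → f x y = h x y)
    (i : Fin n) : dx i f x y = dx i h x y := by
  have hc : ContinuousAt (fun z : Coord n => (z, y)) x := by fun_prop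
  have : (fun z => f z y) =ᶠ[nhds x] fun z => h z y := by
    filter_upwards [hc.preimage_mem_nhds (hU.mem_nhds hp)] with z hz using hfh z y hz
  rw [dx, dx, this.fderiv_eq]

theorem dy_congr (hU : IsOpen U) (hp : (x, y) ∈ U) (hfh : ∀ x y, (x, y) ∈ U → f x y = h x y)
    (i : Fin n) : dy i f x y = dy i h x y := by
  have hc : ContinuousAt (fun w : Coord n => (x, w)) y := by fun_prop
  have : (fun w => f x w) =ᶠ[nhds y] fun w => h x w := by
    filter_upwards [hc.preimage_mem_nhds (hU.mem_nhds hp)] with w hw using hfh x w hw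
  rw [dy, dy, this.fderiv_eq]

/-- Symmetry of the second derivative on the product space; taking basis directions in either factor
gives the commutation of `∂̇_i` with `∂̇_j` and with `∂_i`. -/
theorem fderiv_fderiv_comm (hU : IsOpen U) (hf : SmoothIn U f) (hp : (x, y) ∈ U)
    (v w : Coord n × Coord n) :
    fderiv ℝ (fun q => fderiv ℝ (fun q : Coord n × Coord n => f q.1 q.2) q v) (x, y) w
      = fderiv ℝ (fun q => fderiv ℝ (fun q : Coord n × Coord n => f q.1 q.2) q w) (x, y) v := by
  have hd : DifferentiableAt ℝ (fderiv ℝ (fun q : Coord n × Coord n => f q.1 q.2)) (x, y) :=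
    ((hf.contDiffAt hU hp).fderiv_right (m := 1) (by norm_cast)).differentiableAt (by simp)
  have hs := (hf.contDiffAt hU hp).isSymmSndFDerivAt (by simp; norm_cast)
  have key : ∀ u : Coord n × Coord n,
      fderiv ℝ (fun q => fderiv ℝ (fun q : Coord n × Coord n => f q.1 q.2) q u) (x, y)
        = (fderiv ℝ (fderiv ℝ (fun q : Coord n × Coord n => f q.1 q.2)) (x, y)).flip u := by
    intro u
    rw [fderiv_clm_apply hd (differentiableAt_const u)]
    simp
  rw [key, key]
  exact (hs v w).symm

theorem dy_dy_comm (hU : IsOpen U) (hf : SmoothIn U f) (hp : (x, y) ∈ U) (i j : Fin n) :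
    dy i (dy j f) x y = dy j (dy i f) x y := by
  rw [dy_congr hU hp (fun x y h => hf.dy_eq_fderiv hU h j),
    dy_congr hU hp (fun x y h => hf.dy_eq_fderiv hU h i),
    (hf.fderiv_apply hU _).dy_eq_fderiv hU hp, (hf.fderiv_apply hU _).dy_eq_fderiv hU hp]
  exact fderiv_fderiv_comm hU hf hp _ _

theorem dx_dy_comm (hU : IsOpen U) (hf : SmoothIn U f) (hp : (x, y) ∈ U) (i j : Fin n) :
    dx i (dy j f) x y = dy j (dx i f) x y := by
  rw [dx_congr hU hp (fun x y h => hf.dy_eq_fderiv hU h j),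
    dy_congr hU hp (fun x y h => hf.dx_eq_fderiv hU h i),
    (hf.fderiv_apply hU _).dx_eq_fderiv hU hp, (hf.fderiv_apply hU _).dy_eq_fderiv hU hp]
  exact fderiv_fderiv_comm hU hf hp _ _

section rules

variable (hU : IsOpen U) (hp : (x, y) ∈ U)
include hU hp

theorem dx_add (hf : SmoothIn U f) (hh : SmoothIn U h) (i : Fin n) :
    dx i (fun x y => f x y + h x y) x y = dx i f x y + dx i h x y := by
  simp only [dx]
  rw [fderiv_fun_add (hf.differentiableAt_left hU hp) (hh.differentiableAt_left hU hp)]; rfl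

theorem dy_add (hf : SmoothIn U f) (hh : SmoothIn U h) (i : Fin n) :
    dy i (fun x y => f x y + h x y) x y = dy i f x y + dy i h x y := by
  simp only [dy]
  rw [fderiv_fun_add (hf.differentiableAt_right hU hp) (hh.differentiableAt_right hU hp)]; rfl

theorem dy_sub (hf : SmoothIn U f) (hh : SmoothIn U h) (i : Fin n) :
    dy i (fun x y => f x y - h x y) x y = dy i f x y - dy i h x y := by
  simp only [dy]
  rw [fderiv_fun_sub (hf.differentiableAt_right hU hp) (hh.differentiableAt_right hU hp)]; rfl

theorem dx_mul (hf : SmoothIn U f) (hh : SmoothIn U h) (i : Fin n) :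
    dx i (fun x y => f x y * h x y) x y = dx i f x y * h x y + f x y * dx i h x y := by
  simp only [dx]
  rw [fderiv_fun_mul (hf.differentiableAt_left hU hp) (hh.differentiableAt_left hU hp)]
  simp; ring

theorem dy_mul (hf : SmoothIn U f) (hh : SmoothIn U h) (i : Fin n) :
    dy i (fun x y => f x y * h x y) x y = dy i f x y * h x y + f x y * dy i h x y := by
  simp only [dy]
  rw [fderiv_fun_mul (hf.differentiableAt_right hU hp) (hh.differentiableAt_right hU hp)]
  simp; ring

theorem dx_sum {ι : Type*} {s : Finset ι} {f : ι → Coord n → Coord n → ℝ}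
    (hf : ∀ i, SmoothIn U (f i)) (j : Fin n) :
    dx j (fun x y => ∑ i ∈ s, f i x y) x y = ∑ i ∈ s, dx j (f i) x y := by
  simp only [dx]
  rw [fderiv_fun_sum fun i _ => (hf i).differentiableAt_left hU hp]
  simp

theorem dy_sum {ι : Type*} {s : Finset ι} {f : ι → Coord n → Coord n → ℝ}
    (hf : ∀ i, SmoothIn U (f i)) (j : Fin n) :
    dy j (fun x y => ∑ i ∈ s, f i x y) x y = ∑ i ∈ s, dy j (f i) x y := by
  simp only [dy]
  rw [fderiv_fun_sum fun i _ => (hf i).differentiableAt_right hU hp]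
  simp

omit hU hp in
theorem dx_coord (i j : Fin n) : dx j (fun _ y => y i) x y = 0 := by simp [dx]

omit hU hp in
theorem dy_base (s : Coord n → ℝ) (j : Fin n) : dy j (fun x _ => s x) x y = 0 := by simp [dy]

omit hU hp in
theorem dy_coord (i j : Fin n) : dy j (fun _ y => y i) x y = if i = j then 1 else 0 := by
  have : HasFDerivAt (fun w : Coord n => w i) (EuclideanSpace.proj (𝕜 := ℝ) i) y :=
    (EuclideanSpace.proj (𝕜 := ℝ) i).hasFDerivAt
  rw [dy, this.fderiv]
  simp

theorem dy_contract {A : Fin n → Coord n → Coord n → ℝ} (hA : ∀ i, SmoothIn U (A i)) (j : Fin n) :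
    dy j (fun x y => ∑ i, y i * A i x y) x y = A j x y + ∑ i, y i * dy j (A i) x y := by
  rw [dy_sum hU hp (fun i => (SmoothIn.coord i).mul (hA i))]
  simp_rw [dy_mul hU hp (SmoothIn.coord _) (hA _), dy_coord, Finset.sum_add_distrib]
  simp

theorem dx_contract {A : Fin n → Coord n → Coord n → ℝ} (hA : ∀ i, SmoothIn U (A i)) (j : Fin n) :
    dx j (fun x y => ∑ i, y i * A i x y) x y = ∑ i, y i * dx j (A i) x y := by
  rw [dx_sum hU hp (fun i => (SmoothIn.coord i).mul (hA i))]
  simp_rw [dx_mul hU hp (SmoothIn.coord _) (hA _), dx_coord]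
  simp

theorem dy_sum_mul {A B : Fin n → Coord n → Coord n → ℝ} (hA : ∀ i, SmoothIn U (A i))
    (hB : ∀ i, SmoothIn U (B i)) (j : Fin n) :
    dy j (fun x y => ∑ i, A i x y * B i x y) x y
      = ∑ i, dy j (A i) x y * B i x y + ∑ i, A i x y * dy j (B i) x y := by
  rw [dy_sum hU hp (fun i => (hA i).mul (hB i))]
  simp_rw [dy_mul hU hp (hA _) (hB _), Finset.sum_add_distrib]

end rules

theorem SmoothIn.det {m : ℕ} {A : Fin m → Fin m → Coord n → Coord n → ℝ}
    (hA : ∀ i j, SmoothIn U (A i j)) :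
    SmoothIn U (fun x y => (Matrix.of fun i j => A i j x y).det) := by
  simp only [Matrix.det_apply', Matrix.of_apply]
  exact sum fun σ _ => (const _).mul (prod fun i _ => hA _ _)

theorem SmoothIn.matrix_inv {A : Fin n → Fin n → Coord n → Coord n → ℝ}
    (hA : ∀ i j, SmoothIn U (A i j))
    (h0 : ∀ q ∈ U, (Matrix.of fun i j => A i j q.1 q.2).det ≠ 0) (i j : Fin n) :
    SmoothIn U (fun x y => (Matrix.of fun i j => A i j x y)⁻¹ i j) := by
  simp only [Matrix.inv_def, Ring.inverse_eq_inv', Matrix.smul_apply, smul_eq_mul,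
    Matrix.adjugate_apply]
  refine ((SmoothIn.det hA).inv h0).mul ?_
  -- Cramer's rule: an adjugate entry is the determinant of the matrix with one row replaced by a
  -- constant one, hence again a determinant with smooth entries.
  have : ∀ x y, (Matrix.of fun i j => A i j x y).updateRow j (Pi.single i 1)
      = Matrix.of fun k l => if k = j then (Pi.single i 1 : Fin n → ℝ) l else A k l x y := by
    intro x y; ext k l; simp [Matrix.updateRow_apply]
  simp only [this]
  refine SmoothIn.det (A := fun k l x y => if k = j then (Pi.single i 1 : Fin n → ℝ) l
    else A k l x y) fun k l => ?_
  by_cases hk : k = j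
  · simpa [hk] using SmoothIn.const _
  · simpa [hk] using hA k l

end Calculus

/-! ### Spray and connections of a single metric in coordinates -/

section LocalMetric

variable {n : ℕ}

/-- The slit tangent bundle over `T`, in coordinates. -/
abbrev slit (T : Set (Coord n)) : Set (Coord n × Coord n) := T ×ˢ {y : Coord n | y ≠ 0}

/-- The local expression over `T` of a Finsler metric function. -/
structure IsLocalMetric (T : Set (Coord n)) (L : Coord n → Coord n → ℝ) : Prop where
  isOpen : IsOpen T
  homogeneous : ∀ x ∈ T, ∀ y : Coord n, ∀ c : ℝ, 0 < c → L x (c • y) = c * L x y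
  smooth : SmoothIn (slit T) L
  posDef : ∀ x ∈ T, ∀ y : Coord n, y ≠ 0 → (gMatrix L x y).PosDef

namespace IsLocalMetric

variable {T : Set (Coord n)} {L : Coord n → Coord n → ℝ} (hL : IsLocalMetric T L) {x y : Coord n}
include hL

theorem isOpen_slit : IsOpen (slit T) := hL.isOpen.prod isOpen_ne

theorem smooth_L1 (i : Fin n) : SmoothIn (slit T) (L1 L i) := hL.smooth.dy hL.isOpen_slit i

theorem smooth_L2 (i j : Fin n) : SmoothIn (slit T) (L2 L i j) :=
  (hL.smooth_L1 i).dy hL.isOpen_slit j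

theorem smooth_energy : SmoothIn (slit T) (energy L) :=
  ((hL.smooth.mul hL.smooth).mul (SmoothIn.const (1 / 2))).congr fun _ _ => by
    simp only [energy]; ring

theorem smooth_dyE (i : Fin n) : SmoothIn (slit T) (dy i (energy L)) :=
  hL.smooth_energy.dy hL.isOpen_slit i

theorem smooth_g (i j : Fin n) : SmoothIn (slit T) (g L i j) :=
  (hL.smooth_dyE j).dy hL.isOpen_slit i

theorem det_ne_zero (hp : (x, y) ∈ slit T) : (gMatrix L x y).det ≠ 0 :=
  (hL.posDef x hp.1 y hp.2).det_pos.ne'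

theorem smooth_gInv (i j : Fin n) : SmoothIn (slit T) (gInv L i j) :=
  SmoothIn.matrix_inv hL.smooth_g (fun _ hq => hL.det_ne_zero hq) i j

theorem smooth_spray (i : Fin n) : SmoothIn (slit T) (spray L i) :=
  SmoothIn.sum fun l _ => (hL.smooth_gInv i l).mul <|
    (SmoothIn.sum fun k _ => (SmoothIn.coord k).mul ((hL.smooth_dyE l).dx hL.isOpen_slit k)).sub
      (hL.smooth_energy.dx hL.isOpen_slit l)

/-- Euler's relation: both sides are the derivative of `t ↦ L(x, ty)` at `t = 1`, by the chain rule
and by homogeneity. -/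
theorem euler (hp : (x, y) ∈ slit T) : ∑ i, y i * L1 L i x y = L x y := by
  have hd := hL.smooth.differentiableAt_right hL.isOpen_slit hp
  have h1 : HasDerivAt (fun t : ℝ => L x (t • y)) (fderiv ℝ (fun w => L x w) y y) 1 := by
    have hs : HasDerivAt (fun t : ℝ => t • y) ((1 : ℝ) • y) 1 := (hasDerivAt_id 1).smul_const y
    have hd' : HasFDerivAt (fun w => L x w) (fderiv ℝ (fun w => L x w) y) ((1 : ℝ) • y) := by
      rw [one_smul]; exact hd.hasFDerivAt
    rw [one_smul] at hs
    exact hd'.comp_hasDerivAt 1 hs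
  have h2 : HasDerivAt (fun t : ℝ => L x (t • y)) (L x y) 1 := by
    have : HasDerivAt (fun t : ℝ => t * L x y) (1 * L x y) 1 := (hasDerivAt_id 1).mul_const _
    rw [one_mul] at this
    refine this.congr_of_eventuallyEq ?_
    filter_upwards [lt_mem_nhds (zero_lt_one' ℝ)] with t ht using hL.homogeneous x hp.1 y t ht
  rw [← h1.unique h2]
  have hy : y = ∑ i, y i • EuclideanSpace.single i (1 : ℝ) := by
    simpa using ((EuclideanSpace.basisFun (Fin n) ℝ).sum_repr y).symm
  generalize hD : fderiv ℝ (fun w => L x w) y = D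
  simp only [L1, dy, hD]
  conv_rhs => rw [hy, map_sum]
  simp

theorem L2_symm (hp : (x, y) ∈ slit T) (i j : Fin n) : L2 L i j x y = L2 L j i x y :=
  dy_dy_comm hL.isOpen_slit hL.smooth hp j i

theorem L3_perm (hp : (x, y) ∈ slit T) (i j k : Fin n) : L3 L i j k x y = L3 L i k j x y :=
  dy_dy_comm hL.isOpen_slit (hL.smooth_L1 i) hp k j

/-- Euler's relation differentiated in `y^j`. -/
theorem y_L2 (hp : (x, y) ∈ slit T) (j : Fin n) : ∑ i, y i * L2 L i j x y = 0 := by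
  have h := dy_congr hL.isOpen_slit hp (fun _ _ h => hL.euler h) j
  rw [dy_contract hL.isOpen_slit hp hL.smooth_L1] at h
  exact add_eq_left.1 h

theorem y_dx_L1 (hp : (x, y) ∈ slit T) (j : Fin n) :
    ∑ i, y i * dx j (L1 L i) x y = dx j L x y := by
  rw [← dx_congr hL.isOpen_slit hp (fun _ _ h => hL.euler h) j,
    dx_contract hL.isOpen_slit hp hL.smooth_L1]

theorem dx_L1 (hp : (x, y) ∈ slit T) (i j : Fin n) : dx i (L1 L j) x y = dy j (dx i L) x y :=
  dx_dy_comm hL.isOpen_slit hL.smooth hp i j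

theorem dyE_eq (hp : (x, y) ∈ slit T) (i : Fin n) :
    dy i (energy L) x y = L x y * L1 L i x y := by
  have h := dy_mul hL.isOpen_slit hp (hL.smooth.mul hL.smooth) (SmoothIn.const (1 / 2)) i
  rw [dy_mul hL.isOpen_slit hp hL.smooth hL.smooth, dy_base (fun _ => 1 / 2)] at h
  rw [dy_congr hL.isOpen_slit hp (h := fun x y => L x y * L x y * (1 / 2))
    (fun _ _ _ => by simp only [energy]; ring), h, L1]
  ring

theorem dxE_eq (hp : (x, y) ∈ slit T) (i : Fin n) :
    dx i (energy L) x y = L x y * dx i L x y := by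
  have h := dx_mul hL.isOpen_slit hp (hL.smooth.mul hL.smooth) (SmoothIn.const (1 / 2)) i
  rw [dx_mul hL.isOpen_slit hp hL.smooth hL.smooth] at h
  rw [dx_congr hL.isOpen_slit hp (h := fun x y => L x y * L x y * (1 / 2))
    (fun _ _ _ => by simp only [energy]; ring), h]
  simp only [dx, fderiv_fun_const, Pi.zero_apply, zero_apply]
  ring

theorem dx_dyE_eq (hp : (x, y) ∈ slit T) (i j : Fin n) :
    dx j (dy i (energy L)) x y = dx j L x y * L1 L i x y + L x y * dx j (L1 L i) x y := by
  rw [dx_congr hL.isOpen_slit hp (fun _ _ h => hL.dyE_eq h i),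
    dx_mul hL.isOpen_slit hp hL.smooth (hL.smooth_L1 i)]

theorem g_eq (hp : (x, y) ∈ slit T) (i j : Fin n) :
    g L i j x y = L x y * L2 L i j x y + L1 L i x y * L1 L j x y := by
  rw [g, dy_congr hL.isOpen_slit hp (fun _ _ h => hL.dyE_eq h j),
    dy_mul hL.isOpen_slit hp hL.smooth (hL.smooth_L1 j), hL.L2_symm hp i j]
  simp only [L1, L2]; ring

theorem g_symm (hp : (x, y) ∈ slit T) (i j : Fin n) : g L i j x y = g L j i x y :=
  dy_dy_comm hL.isOpen_slit hL.smooth_energy hp i j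

theorem g_y (hp : (x, y) ∈ slit T) (i : Fin n) : ∑ r, y r * g L i r x y = dy i (energy L) x y := by
  simp_rw [hL.dyE_eq hp, hL.g_eq hp, hL.L2_symm hp i, mul_add, Finset.sum_add_distrib,
    mul_left_comm (y _), ← Finset.mul_sum, hL.y_L2 hp, hL.euler hp]
  ring

/-- Positive definiteness suffices: `y^i y^r g_{ir} = y^i L L_i` would vanish together with `L`. -/
theorem ne_zero (hp : (x, y) ∈ slit T) : L x y ≠ 0 := by
  intro h0
  have hpd := (hL.posDef x hp.1 y hp.2).dotProduct_mulVec_pos (x := y.ofLp)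
    (fun h => hp.2 (by ext i; simp [h]))
  have : star y.ofLp ⬝ᵥ (gMatrix L x y).mulVec y.ofLp = ∑ i, y i * ∑ r, y r * g L i r x y := by
    simp [dotProduct, Matrix.mulVec, gMatrix, mul_comm]
  rw [this] at hpd
  simp [hL.g_y hp, hL.dyE_eq hp, h0] at hpd

/-- Lowers the index in any definition involving `g^{ij}`, so that the inverse matrix never has to
be differentiated explicitly. -/
theorem sum_gInv_eq_iff (hp : (x, y) ∈ slit T) (X V : Fin n → ℝ) :
    (∀ i, X i = ∑ r, gInv L i r x y * V r) ↔ ∀ i, ∑ r, g L i r x y * X r = V i := by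
  have hu : IsUnit (gMatrix L x y).det := (hL.det_ne_zero hp).isUnit
  have e1 : (∀ i, X i = ∑ r, gInv L i r x y * V r) ↔ X = (gMatrix L x y)⁻¹.mulVec V :=
    funext_iff.symm
  have e2 : (∀ i, ∑ r, g L i r x y * X r = V i) ↔ (gMatrix L x y).mulVec X = V :=
    funext_iff.symm
  rw [e1, e2]
  constructor
  · rintro rfl
    rw [Matrix.mulVec_mulVec, Matrix.mul_nonsing_inv _ hu, Matrix.one_mulVec]
  · rintro rfl
    rw [Matrix.mulVec_mulVec, Matrix.nonsing_inv_mul _ hu, Matrix.one_mulVec]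

theorem gInv_symm (hp : (x, y) ∈ slit T) (i j : Fin n) : gInv L i j x y = gInv L j i x y := by
  have h := (hL.posDef x hp.1 y hp.2).1.inv.apply i j
  simpa [gInv] using h.symm

theorem gInv_L1 (hp : (x, y) ∈ slit T) (i : Fin n) :
    ∑ r, gInv L i r x y * L1 L r x y = LUp L i x y := by
  refine ((hL.sum_gInv_eq_iff hp (fun i => LUp L i x y) _).2 (fun i => ?_) i).symm
  have h := hL.g_y hp i
  rw [hL.dyE_eq hp] at h
  have h0 := hL.ne_zero hp
  simp_rw [LUp, mul_div_assoc', ← Finset.sum_div, mul_comm (g L i _ x y), h]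
  field_simp

/-- The equation of geodesics, with the index lowered. -/
theorem g_spray (hp : (x, y) ∈ slit T) (l : Fin n) :
    ∑ r, g L l r x y * spray L r x y
      = (∑ k, y k * dx k (dy l (energy L)) x y) - dx l (energy L) x y :=
  (hL.sum_gInv_eq_iff hp (fun r => spray L r x y) _).1 (fun _ => rfl) l

theorem dy_g_perm (hp : (x, y) ∈ slit T) (i j k : Fin n) :
    dy k (g L i j) x y = dy i (g L k j) x y :=
  dy_dy_comm hL.isOpen_slit (hL.smooth_dyE j) hp k i

theorem y_dy_g (hp : (x, y) ∈ slit T) (i k : Fin n) : ∑ r, y r * dy k (g L i r) x y = 0 := by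
  have h := dy_congr hL.isOpen_slit hp (fun _ _ h => hL.g_y h i) k
  rw [dy_contract hL.isOpen_slit hp (hL.smooth_g i), hL.g_symm hp] at h
  exact add_eq_left.1 h

theorem y_dx_g (hp : (x, y) ∈ slit T) (i k : Fin n) :
    ∑ r, y r * dx k (g L i r) x y = dx k (dy i (energy L)) x y := by
  rw [← dx_congr hL.isOpen_slit hp (fun _ _ h => hL.g_y h i) k,
    dx_contract hL.isOpen_slit hp (hL.smooth_g i)]

theorem dx_g_eq (hp : (x, y) ∈ slit T) (i j k : Fin n) :
    dx k (g L j i) x y = dy j (dx k (dy i (energy L))) x y :=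
  dx_dy_comm hL.isOpen_slit (hL.smooth_dyE i) hp k j

omit hL in
theorem dy_spray (r j : Fin n) : dy j (spray L r) x y = 2 * cartanN L r j x y := by
  rw [cartanN]; ring

/-- The lowered geodesic equation differentiated in `y^j`. -/
theorem g_cartanN (hp : (x, y) ∈ slit T) (l j : Fin n) :
    ∑ r, dy j (g L l r) x y * spray L r x y + 2 * ∑ r, g L l r x y * cartanN L r j x y
      = dx j (dy l (energy L)) x y + ∑ k, y k * dx k (g L j l) x y
        - dx l (dy j (energy L)) x y := by
  have hU := hL.isOpen_slit
  have h := dy_congr hU hp (fun _ _ h => hL.g_spray h l) j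
  rw [dy_sum_mul hU hp (hL.smooth_g l) hL.smooth_spray,
    dy_sub hU hp (SmoothIn.sum fun k _ => (SmoothIn.coord k).mul ((hL.smooth_dyE l).dx hU k))
      (hL.smooth_energy.dx hU l),
    dy_contract hU hp (fun k => (hL.smooth_dyE l).dx hU k),
    ← dx_dy_comm hU hL.smooth_energy hp] at h
  simp_rw [hL.dx_g_eq hp, ← h, dy_spray, Finset.mul_sum, mul_left_comm (2 : ℝ)]

/-- Amounts to homogeneity of degree two of the spray. It is obtained by contracting `g_cartanN`
with `y^j` and comparing with `g_spray`. -/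
theorem y_cartanN (hp : (x, y) ∈ slit T) (r : Fin n) :
    ∑ j, y j * cartanN L r j x y = spray L r x y := by
  have key : ∀ l, ∑ r, g L l r x y * (∑ j, y j * cartanN L r j x y)
      = (∑ k, y k * dx k (dy l (energy L)) x y) - dx l (energy L) x y := by
    intro l
    have h : ∑ j, y j * (∑ r, dy j (g L l r) x y * spray L r x y
        + 2 * ∑ r, g L l r x y * cartanN L r j x y) = _ :=
      Finset.sum_congr rfl fun j _ => congrArg (y j * ·) (hL.g_cartanN hp l j)
    -- `∂̇_j g_{lr}` is totally symmetric and contracts to zero with `y`.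
    have h1 : ∑ j, y j * ∑ r, dy j (g L l r) x y * spray L r x y = 0 := by
      simp_rw [Finset.mul_sum]
      rw [Finset.sum_comm]
      refine Finset.sum_eq_zero fun r _ => ?_
      simp_rw [← mul_assoc, ← Finset.sum_mul]
      refine mul_eq_zero_of_left ?_ _
      rw [← hL.y_dy_g hp r l]
      refine Finset.sum_congr rfl fun j _ => ?_
      rw [hL.dy_g_perm hp l r j, hL.dy_g_perm hp r j l]
      congr 1
      exact dy_congr hL.isOpen_slit hp (fun _ _ h => hL.g_symm h j r) l |>.trans
        (hL.dy_g_perm hp r j l)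
    have h2 : ∑ j, y j * ∑ k, y k * dx k (g L j l) x y
        = ∑ k, y k * dx k (dy l (energy L)) x y := by
      simp_rw [Finset.mul_sum]
      rw [Finset.sum_comm]
      refine Finset.sum_congr rfl fun k _ => ?_
      simp_rw [mul_left_comm (y _) (y k), ← Finset.mul_sum]
      rw [← hL.y_dx_g hp l k]
      congr 1
      refine Finset.sum_congr rfl fun j _ => ?_
      rw [dx_congr hL.isOpen_slit hp (fun _ _ h => hL.g_symm h j l)]
    -- Euler's relation for `∂_l E`, of degree two in `y`.
    have h3 : ∑ j, y j * dx l (dy j (energy L)) x y = 2 * dx l (energy L) x y := by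
      simp_rw [hL.dx_dyE_eq hp, hL.dxE_eq hp, mul_add, Finset.sum_add_distrib,
        mul_left_comm (y _), ← Finset.mul_sum, hL.euler hp, hL.y_dx_L1 hp]
      ring
    simp_rw [mul_sub, mul_add, Finset.sum_sub_distrib, Finset.sum_add_distrib, h1, h2, h3] at h
    have h4 : ∑ j, y j * (2 * ∑ r, g L l r x y * cartanN L r j x y)
        = 2 * ∑ r, g L l r x y * ∑ j, y j * cartanN L r j x y := by
      simp_rw [Finset.mul_sum]
      rw [Finset.sum_comm]
      refine Finset.sum_congr rfl fun r _ => Finset.sum_congr rfl fun j _ => ?_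
      ring
    rw [h4] at h
    linarith
  exact (hL.sum_gInv_eq_iff hp (fun r => ∑ j, y j * cartanN L r j x y) _).2 key r

/-- Contracting an index of `g` with `y` kills the vertical part of `δ_j`, since `y^k ∂̇_r g_{lk} =
0`. -/
theorem y_delta_left (hp : (x, y) ∈ slit T) (l j : Fin n) :
    ∑ k, y k * delta L j (g L l k) x y = dx j (dy l (energy L)) x y := by
  simp_rw [delta, mul_sub, Finset.sum_sub_distrib, hL.y_dx_g hp, Finset.mul_sum]
  rw [Finset.sum_comm]
  simp_rw [mul_left_comm (y _), ← Finset.mul_sum, hL.y_dy_g hp]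
  simp

theorem y_delta (hp : (x, y) ∈ slit T) (f : Coord n → Coord n → ℝ) :
    ∑ k, y k * delta L k f x y
      = ∑ k, y k * dx k f x y - ∑ r, dy r f x y * spray L r x y := by
  simp_rw [delta, mul_sub, Finset.sum_sub_distrib, Finset.mul_sum]
  rw [Finset.sum_comm (f := fun k r => y k * (cartanN L r k x y * dy r f x y))]
  simp_rw [← mul_assoc, ← Finset.sum_mul, hL.y_cartanN hp, mul_comm (spray L _ x y)]

/-- With the index lowered, the three terms of `2 y^k Γ_{ljk}` become `∂_j E_l`, `y^k ∂_k g_{lj} -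
S^r ∂̇_r g_{lj}` and `-∂_l E_j`, where `E_l = ∂̇_l E`. By `g_cartanN` their sum is `2 g_{lr} N^r_j`.
-/
theorem y_Gam (hp : (x, y) ∈ slit T) (r j : Fin n) :
    cartanN L r j x y = ∑ k, y k * Gam L r j k x y := by
  have key : ∀ l, ∑ r, g L l r x y * (2 * cartanN L r j x y)
      = ∑ k, y k * (delta L j (g L l k) x y + delta L k (g L l j) x y
          - delta L l (g L j k) x y) := by
    intro l
    simp_rw [mul_sub, mul_add, Finset.sum_sub_distrib, Finset.sum_add_distrib,
      hL.y_delta_left hp, hL.y_delta hp, mul_left_comm _ (2 : ℝ), ← Finset.mul_sum]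
    have h := hL.g_cartanN hp l j
    have e1 : ∑ r, dy j (g L l r) x y * spray L r x y
        = ∑ r, dy r (g L l j) x y * spray L r x y := by
      refine Finset.sum_congr rfl fun r _ => ?_
      rw [hL.dy_g_perm hp l j r, dy_congr hL.isOpen_slit hp (fun _ _ h => hL.g_symm h l r) j,
        hL.dy_g_perm hp r l j, hL.dy_g_perm hp r j l,
        dy_congr hL.isOpen_slit hp (fun _ _ h => hL.g_symm h j l) r]
    have e2 : ∑ k, y k * dx k (g L j l) x y = ∑ k, y k * dx k (g L l j) x y :=
      Finset.sum_congr rfl fun k _ => by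
        rw [dx_congr hL.isOpen_slit hp (fun _ _ h => hL.g_symm h j l)]
    rw [e1, e2] at h
    linarith
  have h := (hL.sum_gInv_eq_iff hp (fun r => 2 * cartanN L r j x y) _).2 key r
  have : cartanN L r j x y = 1 / 2 * (2 * cartanN L r j x y) := by ring
  rw [this]
  simp only at h
  rw [h]
  simp_rw [Gam, Finset.mul_sum]
  rw [Finset.sum_comm]
  refine Finset.sum_congr rfl fun r _ => Finset.sum_congr rfl fun j _ => ?_
  ring

theorem Gam_symm (hp : (x, y) ∈ slit T) (r j k : Fin n) :
    Gam L r j k x y = Gam L r k j x y := by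
  have : ∀ l, delta L l (g L j k) x y = delta L l (g L k j) x y := fun l => by
    simp only [delta]
    rw [dx_congr hL.isOpen_slit hp (fun _ _ h => hL.g_symm h j k)]
    simp_rw [dy_congr hL.isOpen_slit hp (fun _ _ h => hL.g_symm h j k)]
  simp only [Gam]
  congr 1
  refine Finset.sum_congr rfl fun l _ => ?_
  rw [this l]; ring

/-- Conservation of `L` along geodesics: contract the lowered geodesic equation with `y^l` and
cancel `L`. -/
theorem L1_spray (hp : (x, y) ∈ slit T) :
    ∑ r, L1 L r x y * spray L r x y = ∑ k, y k * dx k L x y := by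
  have h : ∑ l, y l * ∑ r, g L l r x y * spray L r x y = _ :=
    Finset.sum_congr rfl fun l _ => congrArg (y l * ·) (hL.g_spray hp l)
  have e1 : ∑ l, y l * ∑ r, g L l r x y * spray L r x y
      = L x y * ∑ r, L1 L r x y * spray L r x y := by
    simp_rw [Finset.mul_sum]
    rw [Finset.sum_comm]
    refine Finset.sum_congr rfl fun r _ => ?_
    simp_rw [← mul_assoc, ← Finset.sum_mul, hL.g_symm hp _ r, hL.g_y hp, hL.dyE_eq hp]
  have e2 : ∑ l, y l * ∑ k, y k * dx k (dy l (energy L)) x y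
      = 2 * (L x y * ∑ k, y k * dx k L x y) := by
    simp_rw [hL.dx_dyE_eq hp, Finset.mul_sum]
    rw [Finset.sum_comm]
    refine Finset.sum_congr rfl fun k _ => ?_
    simp_rw [mul_left_comm _ (y k), ← Finset.mul_sum, mul_add, Finset.sum_add_distrib,
      mul_left_comm (y _), ← Finset.mul_sum, hL.euler hp, hL.y_dx_L1 hp]
    ring
  have e3 : ∑ l, y l * dx l (energy L) x y = L x y * ∑ k, y k * dx k L x y := by
    simp_rw [hL.dxE_eq hp, Finset.mul_sum]
    exact Finset.sum_congr rfl fun _ _ => by ring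
  simp_rw [mul_sub, Finset.sum_sub_distrib] at h
  rw [e1, e2, e3] at h
  exact mul_left_cancel₀ (hL.ne_zero hp) (by linarith)

/-- The Euler–Lagrange equation of `L` itself. After inserting `g = L L_{ij} + L_i L_j`, the
rank-one part cancels by `L1_spray`, and `L` is divided out. -/
theorem L2_spray (hp : (x, y) ∈ slit T) (l : Fin n) :
    ∑ r, L2 L l r x y * spray L r x y = ∑ k, y k * dx k (L1 L l) x y - dx l L x y := by
  have h := hL.g_spray hp l
  simp_rw [hL.g_eq hp, hL.dx_dyE_eq hp, hL.dxE_eq hp, add_mul, mul_add, Finset.sum_add_distrib,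
    mul_assoc, mul_left_comm (y _) (L x y), ← Finset.mul_sum, hL.L1_spray hp,
    ← mul_assoc, ← Finset.sum_mul] at h
  exact mul_left_cancel₀ (hL.ne_zero hp) (by linarith)

/-- The metric function is horizontally constant. -/
theorem L1_cartanN (hp : (x, y) ∈ slit T) (j : Fin n) :
    ∑ r, L1 L r x y * cartanN L r j x y = dx j L x y := by
  have hU := hL.isOpen_slit
  -- Differentiating `L1_spray` in `y^j` gives `L_{rj} S^r + 2 L_r N^r_j = ∂_j L + y^k ∂_k L_j`; the
  -- first term is known from `L2_spray`.
  have h := dy_congr hU hp (fun _ _ h => hL.L1_spray h) j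
  rw [dy_sum_mul hU hp hL.smooth_L1 hL.smooth_spray,
    dy_contract hU hp (fun k => hL.smooth.dx hU k)] at h
  have e1 : ∑ r, dy j (L1 L r) x y * spray L r x y
      = ∑ k, y k * dx k (L1 L j) x y - dx j L x y := by
    rw [← hL.L2_spray hp]
    exact Finset.sum_congr rfl fun r _ => by rw [hL.L2_symm hp]; rfl
  simp_rw [e1, dy_spray, mul_left_comm _ (2 : ℝ), ← Finset.mul_sum, ← hL.dx_L1 hp] at h
  linarith

end IsLocalMetric

end LocalMetric

/-! ### The `β`-conformal change in coordinates -/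

section LocalChange

variable {n : ℕ} {T : Set (Coord n)} {L : Coord n → Coord n → ℝ} {x y : Coord n}

theorem slit_subset : slit T ⊆ T ×ˢ Set.univ := Set.prod_mono_right (Set.subset_univ _)

theorem dx_base (s : Coord n → ℝ) (k : Fin n) : dx k (fun x _ => s x) x y = sig s k x := rfl

theorem smoothIn_sig (hT : IsOpen T) {s : Coord n → ℝ} (hs : ContDiffOn ℝ ∞ s T) (k : Fin n) :
    SmoothIn (slit T) (fun x _ => sig s k x) :=
  (SmoothIn.of_base hs slit_subset).dx (hT.prod isOpen_ne) k

theorem sig_exp (hT : IsOpen T) {s : Coord n → ℝ} (hs : ContDiffOn ℝ ∞ s T) (hx : x ∈ T)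
    (k : Fin n) : sig (fun z => Real.exp (s z)) k x = Real.exp (s x) * sig s k x := by
  have hd : DifferentiableAt ℝ s x :=
    (hs.contDiffAt (hT.mem_nhds hx)).differentiableAt (by simp)
  rw [sig, fderiv_exp hd]; rfl

theorem hcov_eq (L : Coord n → Coord n → ℝ) (b : Fin n → Coord n → ℝ) (i j : Fin n) :
    hcov L (fun k x _ => b k x) i j x y = sig (b i) j x - ∑ r, b r x * Gam L r i j x y := by
  simp [hcov, delta, dy_base, dx_base]

namespace IsLocalMetric

/-- The symmetric `Γ` drops out, leaving a function of `x` alone, which `∂̇_j` does not see. -/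
theorem Fanti_eq (hL : IsLocalMetric T L) (hp : (x, y) ∈ slit T) (b : Fin n → Coord n → ℝ)
    (i j : Fin n) : Fanti L b i j x y = (sig (b i) j x - sig (b j) i x) / 2 := by
  simp_rw [Fanti, hcov_eq, hL.Gam_symm hp _ j i]
  ring

/-- `F_{j0}` contracts the second index of an antisymmetric tensor, so the difference is `y^i
b_{i|j}`, whose connection part is `b_r N^r_j`. -/
theorem E0_sub_F0 (hL : IsLocalMetric T L) (hp : (x, y) ∈ slit T) (b : Fin n → Coord n → ℝ)
    (j : Fin n) : E0 L b j x y - F0 L b j x y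
      = ∑ i, y i * sig (b i) j x - ∑ r, b r x * cartanN L r j x y := by
  have : E0 L b j x y - F0 L b j x y = ∑ i, y i * hcov L (fun k x _ => b k x) i j x y := by
    rw [E0, F0, ← Finset.sum_sub_distrib]
    refine Finset.sum_congr rfl fun i _ => ?_
    simp only [Esym, Fanti]; ring
  rw [this]
  simp_rw [hcov_eq, mul_sub, Finset.sum_sub_distrib, hL.y_Gam hp, Finset.mul_sum]
  rw [Finset.sum_comm (f := fun i r => y i * (b r x * Gam L r i j x y))]
  congr 1
  refine Finset.sum_congr rfl fun r _ => Finset.sum_congr rfl fun i _ => ?_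
  rw [hL.Gam_symm hp r i j]; ring

theorem E00_eq (hL : IsLocalMetric T L) (hp : (x, y) ∈ slit T) (b : Fin n → Coord n → ℝ) :
    E00 L b x y
      = ∑ j, y j * ∑ i, y i * sig (b i) j x - ∑ r, b r x * spray L r x y := by
  -- By antisymmetry; hence `E_{00}` may be computed from `E_{0j} - F_{j0}`.
  have h1 : ∑ j, y j * F0 L b j x y = 0 := by
    have h : ∑ j, y j * F0 L b j x y = -∑ j, y j * F0 L b j x y := by
      simp_rw [F0, Finset.mul_sum]
      conv_rhs => rw [Finset.sum_comm]
      simp_rw [← Finset.sum_neg_distrib]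
      refine Finset.sum_congr rfl fun i _ => Finset.sum_congr rfl fun j _ => ?_
      simp only [Fanti]; ring
    linarith
  have h2 : E00 L b x y = ∑ j, y j * E0 L b j x y := by
    simp_rw [E00, E0, Finset.mul_sum]
    rw [Finset.sum_comm]
    refine Finset.sum_congr rfl fun i _ => Finset.sum_congr rfl fun j _ => ?_
    ring
  have h3 : E00 L b x y = ∑ j, y j * (E0 L b j x y - F0 L b j x y) := by
    simp_rw [mul_sub, Finset.sum_sub_distrib, h1, h2, sub_zero]
  rw [h3]
  simp_rw [hL.E0_sub_F0 hp, mul_sub, Finset.sum_sub_distrib, ← hL.y_cartanN hp, Finset.mul_sum]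
  rw [Finset.sum_comm (f := fun i r => y i * (b r x * cartanN L r i x y))]
  congr 1
  refine Finset.sum_congr rfl fun r _ => Finset.sum_congr rfl fun i _ => ?_
  ring

theorem bUp_contract (hL : IsLocalMetric T L) (hp : (x, y) ∈ slit T) (b : Fin n → Coord n → ℝ)
    (v : Fin n → ℝ) :
    ∑ r, bUp L b r x y * v r = ∑ j, b j x * ∑ r, gInv L j r x y * v r := by
  simp_rw [bUp, Finset.sum_mul, Finset.mul_sum]
  rw [Finset.sum_comm]
  refine Finset.sum_congr rfl fun r _ => Finset.sum_congr rfl fun i _ => ?_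
  rw [hL.gInv_symm hp i r]; ring

theorem diff00_eq {M : Coord n → Coord n → ℝ} (hL : IsLocalMetric T L) (hM : IsLocalMetric T M)
    (hp : (x, y) ∈ slit T) (r : Fin n) :
    diff00 L M r x y = spray M r x y - spray L r x y := by
  rw [← hL.y_cartanN hp, ← hM.y_cartanN hp]
  simp_rw [hL.y_Gam hp, hM.y_Gam hp, diff00, diffTensor, ← Finset.sum_sub_distrib,
    Finset.mul_sum, ← Finset.sum_sub_distrib]
  refine Finset.sum_congr rfl fun r _ => Finset.sum_congr rfl fun i _ => ?_
  ring

theorem diff0_eq {M : Coord n → Coord n → ℝ} (hL : IsLocalMetric T L) (hM : IsLocalMetric T M)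
    (hp : (x, y) ∈ slit T) (r j : Fin n) :
    diff0 L M r j x y = cartanN M r j x y - cartanN L r j x y := by
  simp_rw [hL.y_Gam hp, hM.y_Gam hp, diff0, diffTensor, ← Finset.sum_sub_distrib]
  refine Finset.sum_congr rfl fun i _ => ?_
  -- `D^r_{0j}` contracts the first lower index of `Γ`, `y_Gam` the second.
  rw [hL.Gam_symm hp r j i, hM.Gam_symm hp r j i]; ring

end IsLocalMetric

/-- The local expression over `T` of a `β`-conformal change `M = e^s L + b_i y^i`. -/
structure IsLocalChange (T : Set (Coord n)) (L M : Coord n → Coord n → ℝ) (s : Coord n → ℝ)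
    (b : Fin n → Coord n → ℝ) : Prop where
  left : IsLocalMetric T L
  right : IsLocalMetric T M
  smooth_s : ContDiffOn ℝ ∞ s T
  smooth_b : ∀ i, ContDiffOn ℝ ∞ (b i) T
  eq : ∀ x ∈ T, ∀ y, M x y = Real.exp (s x) * L x y + ∑ i, y i * b i x

namespace IsLocalChange

variable {M : Coord n → Coord n → ℝ} {s : Coord n → ℝ} {b : Fin n → Coord n → ℝ}
  (h : IsLocalChange T L M s b)
include h

theorem smoothIn_exp : SmoothIn (slit T) (fun x _ => Real.exp (s x)) :=
  SmoothIn.of_base (Real.contDiff_exp.comp_contDiffOn h.smooth_s) slit_subset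

theorem smoothIn_b (i : Fin n) : SmoothIn (slit T) (fun x _ => b i x) :=
  SmoothIn.of_base (h.smooth_b i) slit_subset

theorem smoothIn_form : SmoothIn (slit T) (fun x y => ∑ i, y i * b i x) :=
  SmoothIn.sum fun i _ => (SmoothIn.coord i).mul (h.smoothIn_b i)

theorem L1_eq (hp : (x, y) ∈ slit T) (i : Fin n) :
    L1 M i x y = Real.exp (s x) * L1 L i x y + b i x := by
  have hU := h.left.isOpen_slit
  rw [L1, dy_congr hU hp (fun x y hp => h.eq x hp.1 y),
    dy_add hU hp (h.smoothIn_exp.mul h.left.smooth) h.smoothIn_form,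
    dy_mul hU hp h.smoothIn_exp h.left.smooth, dy_contract hU hp h.smoothIn_b]
  simp [dy_base, L1, dy_base (fun x => Real.exp (s x))]

theorem L2_eq (hp : (x, y) ∈ slit T) (i j : Fin n) :
    L2 M i j x y = Real.exp (s x) * L2 L i j x y := by
  have hU := h.left.isOpen_slit
  rw [L2, dy_congr hU hp (fun x y hp => h.L1_eq hp i),
    dy_add hU hp (h.smoothIn_exp.mul (h.left.smooth_L1 i)) (h.smoothIn_b i),
    dy_mul hU hp h.smoothIn_exp (h.left.smooth_L1 i)]
  simp [dy_base, L2, dy_base (fun x => Real.exp (s x))]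

theorem dx_eq (hp : (x, y) ∈ slit T) (k : Fin n) :
    dx k M x y = Real.exp (s x) * (sig s k x * L x y + dx k L x y)
      + ∑ i, y i * sig (b i) k x := by
  have hU := h.left.isOpen_slit
  rw [dx_congr hU hp (fun x y hp => h.eq x hp.1 y),
    dx_add hU hp (h.smoothIn_exp.mul h.left.smooth) h.smoothIn_form,
    dx_mul hU hp h.smoothIn_exp h.left.smooth, dx_contract hU hp h.smoothIn_b,
    dx_base (fun x => Real.exp (s x)), sig_exp h.left.isOpen h.smooth_s hp.1]
  simp only [dx_base]
  ring

theorem dx_L1_eq (hp : (x, y) ∈ slit T) (i k : Fin n) :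
    dx k (L1 M i) x y = Real.exp (s x) * (sig s k x * L1 L i x y + dx k (L1 L i) x y)
      + sig (b i) k x := by
  have hU := h.left.isOpen_slit
  rw [dx_congr hU hp (fun x y hp => h.L1_eq hp i),
    dx_add hU hp (h.smoothIn_exp.mul (h.left.smooth_L1 i)) (h.smoothIn_b i),
    dx_mul hU hp h.smoothIn_exp (h.left.smooth_L1 i),
    dx_base (fun x => Real.exp (s x)), sig_exp h.left.isOpen h.smooth_s hp.1]
  simp only [dx_base]
  ring

theorem form_eq (hp : (x, y) ∈ slit T) :
    ∑ i, b i x * LUp L i x y = (M x y - Real.exp (s x) * L x y) / L x y := by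
  rw [h.eq x hp.1 y, add_sub_cancel_left, Finset.sum_div]
  exact Finset.sum_congr rfl fun i _ => by rw [LUp]; ring

/-- A vector is determined by its contractions with `L_{ij}` and `L̄_i`. -/
theorem eq_of_contract (hp : (x, y) ∈ slit T) (X v : Fin n → ℝ) (w : ℝ)
    (hv : ∀ i, ∑ r, L2 L i r x y * X r = v i) (hw : ∑ r, L1 M r x y * X r = w) (i : Fin n) :
    X i = L x y * ∑ r, gInv L i r x y * v r
      + L x y / M x y * (w - L x y * ∑ r, bUp L b r x y * v r) * LUp L i x y := by
  have hL0 := h.left.ne_zero hp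
  have hM0 := h.right.ne_zero hp
  -- The one unknown left: lowering the index, `g_{ir} X^r = L v_i + P L_i`, so `X` is explicit once
  -- `P` is known.
  set P := ∑ r, L1 L r x y * X r with hP
  have hX : ∀ i, X i = L x y * ∑ r, gInv L i r x y * v r + P * LUp L i x y := by
    have key := (h.left.sum_gInv_eq_iff hp X (fun i => L x y * v i + P * L1 L i x y)).2
      (fun i => by
        simp_rw [h.left.g_eq hp, add_mul, Finset.sum_add_distrib, mul_assoc, ← Finset.mul_sum,
          hv, ← hP]
        ring)
    intro i
    rw [key i, ← h.left.gInv_L1 hp]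
    simp_rw [mul_add, Finset.sum_add_distrib, Finset.mul_sum]
    congr 1 <;> exact Finset.sum_congr rfl fun r _ => by ring
  have hbX : ∑ i, b i x * X i = L x y * ∑ r, bUp L b r x y * v r
      + P * ((M x y - Real.exp (s x) * L x y) / L x y) := by
    rw [← h.form_eq hp, h.left.bUp_contract hp]
    simp_rw [Finset.mul_sum, ← Finset.sum_add_distrib]
    refine Finset.sum_congr rfl fun i _ => ?_
    rw [hX i, mul_add, Finset.mul_sum, Finset.mul_sum]
    congr 1
    · exact Finset.sum_congr rfl fun r _ => by ring
    · ring
  have hwP : w = Real.exp (s x) * P + ∑ i, b i x * X i := by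
    rw [← hw, hP, Finset.mul_sum, ← Finset.sum_add_distrib]
    refine Finset.sum_congr rfl fun i _ => ?_
    rw [h.L1_eq hp]; ring
  -- As `b_i y^i / L = (L̄ - e^σ L) / L`, the coefficient of `P` in `w = e^σ P + b_i X^i` is `L̄ /
  -- L`.
  have hPw : L x y / M x y * (w - L x y * ∑ r, bUp L b r x y * v r) = P := by
    rw [hwP, hbX]; field_simp; ring
  rw [hPw]
  exact hX i

/-- The Euler–Lagrange equations of the two metrics have proportional left-hand matrices, `L̄_{ij} =
e^σ L_{ij}`. They can therefore be subtracted; only derivatives of `σ` and the curl of `b` survive.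
-/
theorem L2_diff (hp : (x, y) ∈ slit T) (i : Fin n) :
    ∑ r, L2 L i r x y * (spray M r x y - spray L r x y)
      = sig0 s x y * L1 L i x y - sig s i x * L x y + 2 * Real.exp (-s x) * F0 L b i x y := by
  have h1 := h.right.L2_spray hp i
  have h2 := h.left.L2_spray hp i
  simp_rw [h.L2_eq hp, h.dx_L1_eq hp, h.dx_eq hp, mul_add, Finset.sum_add_distrib, mul_assoc,
    mul_left_comm (y _) (Real.exp _), ← Finset.mul_sum] at h1
  have h3 : ∑ k, y k * (sig s k x * L1 L i x y) = sig0 s x y * L1 L i x y := by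
    rw [sig0, Finset.sum_mul]; exact Finset.sum_congr rfl fun k _ => by ring
  have h4 : 2 * F0 L b i x y = ∑ k, y k * sig (b i) k x - ∑ k, y k * sig (b k) i x := by
    rw [F0, ← Finset.sum_sub_distrib, Finset.mul_sum]
    refine Finset.sum_congr rfl fun k _ => ?_
    rw [h.left.Fanti_eq hp]; ring
  have h5 : Real.exp (-s x) = (Real.exp (s x))⁻¹ := Real.exp_neg _
  have h6 : Real.exp (s x) ≠ 0 := Real.exp_ne_zero _
  simp_rw [mul_sub, Finset.sum_sub_distrib]
  refine mul_left_cancel₀ h6 ?_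
  rw [h3] at h1
  rw [mul_sub, h1, h2, mul_comm 2, mul_assoc, h4, h5]
  field_simp
  ring

theorem L1_diff (hp : (x, y) ∈ slit T) :
    ∑ r, L1 M r x y * (spray M r x y - spray L r x y)
      = Real.exp (s x) * L x y * sig0 s x y + E00 L b x y := by
  simp_rw [mul_sub, Finset.sum_sub_distrib, h.right.L1_spray hp, h.L1_eq hp, h.dx_eq hp,
    mul_add, add_mul, Finset.sum_add_distrib, mul_assoc, mul_left_comm (y _) (Real.exp _),
    ← Finset.mul_sum, h.left.L1_spray hp, h.left.E00_eq hp]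
  have h3 : ∑ k, y k * (sig s k x * L x y) = sig0 s x y * L x y := by
    rw [sig0, Finset.sum_mul]; exact Finset.sum_congr rfl fun k _ => by ring
  rw [h3]; ring

theorem spray_diff (hp : (x, y) ∈ slit T) (r : Fin n) :
    spray M r x y - spray L r x y = D00 L M s b r x y := by
  have hL0 := h.left.ne_zero hp
  have hM0 := h.right.ne_zero hp
  have h6 : Real.exp (s x) ≠ 0 := Real.exp_ne_zero _
  rw [h.eq_of_contract hp (fun r => spray M r x y - spray L r x y) _ _ (h.L2_diff hp)
    (h.L1_diff hp) r]
  have e1 : ∑ k, gInv L r k x y * (sig0 s x y * L1 L k x y - sig s k x * L x y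
      + 2 * Real.exp (-s x) * F0 L b k x y)
      = sig0 s x y * LUp L r x y - L x y * sigUp L s r x y
        + 2 * Real.exp (-s x) * F0Up L b r x y := by
    rw [← h.left.gInv_L1 hp, sigUp, F0Up]
    simp_rw [Finset.mul_sum, ← Finset.sum_sub_distrib, ← Finset.sum_add_distrib]
    refine Finset.sum_congr rfl fun k _ => ?_
    rw [h.left.gInv_symm hp k r]; ring
  have e2 : ∑ k, bUp L b k x y * (sig0 s x y * L1 L k x y - sig s k x * L x y
      + 2 * Real.exp (-s x) * F0 L b k x y)
      = sig0 s x y * ((M x y - Real.exp (s x) * L x y) / L x y) - L x y * sigBeta L s b x y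
        + 2 * Real.exp (-s x) * FBeta0 L b x y := by
    rw [← h.form_eq hp, sigBeta, FBeta0]
    simp_rw [← h.left.gInv_L1 hp]
    rw [← h.left.bUp_contract hp]
    simp_rw [Finset.mul_sum, ← Finset.sum_sub_distrib, ← Finset.sum_add_distrib]
    refine Finset.sum_congr rfl fun k _ => ?_
    ring
  -- The term `L σ_0 L^r` cancels against the `L̄` part of `b^k L_k`, which leaves `σ_0` with the
  -- doubled coefficient `2 L e^σ` of `D00`.
  rw [e1, e2, D00]
  field_simp
  ring

theorem L2_diffN (hp : (x, y) ∈ slit T) (i j : Fin n) :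
    ∑ r, L2 L i r x y * (cartanN M r j x y - cartanN L r j x y) = G2 L M s b i j x y := by
  have hU := h.left.isOpen_slit
  have hsig := smoothIn_sig h.left.isOpen h.smooth_s
  have hsig0 : SmoothIn (slit T) (fun x y => ∑ k, y k * sig s k x) :=
    SmoothIn.sum fun k _ => (SmoothIn.coord k).mul (hsig k)
  have hexp : SmoothIn (slit T) (fun x _ => 2 * Real.exp (-s x)) :=
    (SmoothIn.const 2).mul (SmoothIn.of_base
      (Real.contDiff_exp.comp_contDiffOn h.smooth_s.neg) slit_subset)
  have hF : ∀ k, SmoothIn (slit T) (fun x _ => (sig (b i) k x - sig (b k) i x) * (1 / 2)) :=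
    fun k => ((smoothIn_sig h.left.isOpen (h.smooth_b i) k).sub
      (smoothIn_sig h.left.isOpen (h.smooth_b k) i)).mul (SmoothIn.const _)
  have hF0 : SmoothIn (slit T)
      (fun x y => ∑ k, y k * ((sig (b i) k x - sig (b k) i x) * (1 / 2))) :=
    SmoothIn.sum fun k _ => (SmoothIn.coord k).mul (hF k)
  -- `L2_diff` with every `y`-dependence made explicit. Applying `∂̇_j` gives `L_{ijr} D^r_{00} + 2
  -- L_{ir} (N̄^r_j - N^r_j)` on the left, whence the factors `1/2` in `G2`.
  have key : ∀ x y, (x, y) ∈ slit T → ∑ r, L2 L i r x y * (spray M r x y - spray L r x y)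
      = (∑ k, y k * sig s k x) * L1 L i x y - sig s i x * L x y
        + 2 * Real.exp (-s x) * ∑ k, y k * ((sig (b i) k x - sig (b k) i x) * (1 / 2)) := by
    intro x y hp
    rw [h.L2_diff hp, sig0, F0]
    congr 2
    · congr 1
      exact Finset.sum_congr rfl fun k _ => mul_comm _ _
    · exact Finset.sum_congr rfl fun k _ => by rw [h.left.Fanti_eq hp]; ring
  have hd := dy_congr hU hp key j
  rw [dy_sum_mul hU hp (h.left.smooth_L2 i)
      (fun r => (h.right.smooth_spray r).sub (h.left.smooth_spray r)),
    dy_add hU hp ((hsig0.mul (h.left.smooth_L1 i)).sub ((hsig i).mul h.left.smooth))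
      (hexp.mul hF0),
    dy_sub hU hp (hsig0.mul (h.left.smooth_L1 i)) ((hsig i).mul h.left.smooth),
    dy_mul hU hp hsig0 (h.left.smooth_L1 i), dy_mul hU hp (hsig i) h.left.smooth,
    dy_mul hU hp hexp hF0, dy_contract hU hp hsig, dy_contract hU hp hF,
    dy_base (sig s i), dy_base (fun x => 2 * Real.exp (-s x))] at hd
  simp_rw [dy_base (sig s _), dy_base (fun x => (sig (b i) _ x - sig (b _) i x) * (1 / 2)),
    dy_sub hU hp (h.right.smooth_spray _) (h.left.smooth_spray _), IsLocalMetric.dy_spray,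
    h.spray_diff hp, ← mul_sub, mul_left_comm _ (2 : ℝ), ← Finset.mul_sum] at hd
  have e1 : ∑ r, dy j (L2 L i r) x y * D00 L M s b r x y
      = ∑ r, L3 L i j r x y * D00 L M s b r x y :=
    Finset.sum_congr rfl fun r _ => by rw [h.left.L3_perm hp i j r]; rfl
  have e2 : sig0 s x y = ∑ k, y k * sig s k x :=
    Finset.sum_congr rfl fun k _ => mul_comm _ _
  rw [e1, ← e2] at hd
  simp only [mul_zero, Finset.sum_const_zero] at hd
  rw [G2, h.left.Fanti_eq hp, mu]
  rw [show dy j (L1 L i) x y = L2 L i j x y from rfl,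
    show dy j L x y = L1 L j x y from rfl] at hd
  linarith

/-- Horizontal constancy of both metrics gives `e^σ σ_j L + E_{0j} - F_{j0}`; `L2_diff` trades
`F_{j0}` for `L_{jr} D^r_{00}`, which is the form of `G1`. -/
theorem L1_diffN (hp : (x, y) ∈ slit T) (j : Fin n) :
    ∑ r, L1 M r x y * (cartanN M r j x y - cartanN L r j x y) = G1 L M s b j x y := by
  have h1 : ∑ r, L1 M r x y * (cartanN M r j x y - cartanN L r j x y)
      = Real.exp (s x) * (sig s j x * L x y) + (E0 L b j x y - F0 L b j x y) := by
    simp_rw [mul_sub, Finset.sum_sub_distrib, h.right.L1_cartanN hp, h.L1_eq hp, add_mul,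
      Finset.sum_add_distrib, mul_assoc, ← Finset.mul_sum, h.left.L1_cartanN hp,
      h.left.E0_sub_F0 hp, h.dx_eq hp]
    ring
  have h2 := h.L2_diff hp j
  simp_rw [h.spray_diff hp] at h2
  rw [h1, G1, mul_assoc (1 / 2), h2, Real.exp_neg]
  have h6 : Real.exp (s x) ≠ 0 := Real.exp_ne_zero _
  field_simp
  ring

theorem cartanN_diff (hp : (x, y) ∈ slit T) (r j : Fin n) :
    cartanN M r j x y - cartanN L r j x y = D0 L M s b r j x y :=
  h.eq_of_contract hp (fun r => cartanN M r j x y - cartanN L r j x y) _ _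
    (fun i => h.L2_diffN hp i j) (h.L1_diffN hp j) r

end IsLocalChange

theorem IsFinslerMetric.isLocalMetric {M : Type*} [TopologicalSpace M] [ChartedSpace (Coord n) M]
    {L : TangentBundle (𝓡 n) M → ℝ} (hL : IsFinslerMetric L)
    {φ : OpenPartialHomeomorph M (Coord n)} (hφ : φ ∈ IsManifold.maximalAtlas (𝓡 n) ∞ M) :
    IsLocalMetric φ.target (coordRep φ L) where
  isOpen := φ.open_target
  homogeneous x _ y c hc := by
    have : tangentVec φ x (c • y) = c • tangentVec φ x y := map_smul _ _ _
    rw [coordRep, this, hL.homogeneous _ _ _ hc]; rfl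
  smooth := hL.smooth φ hφ
  posDef := hL.posDef φ hφ

end LocalChange

end FinslerCoord

/-! ### From charts of the manifold to coordinates -/

open FinslerCoord in
theorem isLocalChange_coordRep {n : ℕ} {M : Type*} [TopologicalSpace M]
    [ChartedSpace (Coord n) M] [IsManifold (𝓡 n) ∞ M]
    {L : TangentBundle (𝓡 n) M → ℝ} (hL : IsFinslerMetric L)
    {σ : M → ℝ} (hσ : ContMDiff (𝓡 n) 𝓘(ℝ, ℝ) ∞ σ)
    {β : ∀ p : M, TangentSpace (𝓡 n) p →L[ℝ] ℝ} (hβ : IsSmoothOneForm β)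
    (hLbar : IsFinslerMetric (betaConformalChange σ β L))
    {φ : OpenPartialHomeomorph M (Coord n)} (hφ : φ ∈ IsManifold.maximalAtlas (𝓡 n) ∞ M) :
    IsLocalChange φ.target (coordRep φ L) (coordRep φ (betaConformalChange σ β L))
      (fun z => σ (φ.symm z)) (formComp φ β) where
  left := hL.isLocalMetric hφ
  right := hLbar.isLocalMetric hφ
  smooth_s := contMDiffOn_iff_contDiffOn.1
    (hσ.comp_contMDiffOn (contMDiffOn_symm_of_mem_maximalAtlas hφ))
  smooth_b := hβ φ hφ
  eq x _ y := by
    have hy : y = ∑ i, y i • EuclideanSpace.single i (1 : ℝ) := by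
      simpa using ((EuclideanSpace.basisFun (Fin n) ℝ).sum_repr y).symm
    have h1 : β (φ.symm x) (tangentVec φ x y) = ∑ i, y i * formComp φ β i x := by
      -- The form pulled back to the model space, where `y` can be expanded in the standard basis.
      let ψ : Coord n →ₗ[ℝ] ℝ :=
        (β (φ.symm x)).toLinearMap ∘ₗ (mfderiv (𝓡 n) (𝓡 n) φ.symm x).toLinearMap
      change ψ y = ∑ i, y i * ψ (EuclideanSpace.single i 1)
      conv_lhs => rw [hy, map_sum]
      simp
    simp only [coordRep, betaConformalChange, h1]

end

theorem proposition4p3 {n : ℕ} {M : Type*} [TopologicalSpace M]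
    [ChartedSpace (FinslerCoord.Coord n) M] [IsManifold (𝓡 n) ∞ M]
    (L : TangentBundle (𝓡 n) M → ℝ) (hL : FinslerCoord.IsFinslerMetric L)
    (σ : M → ℝ) (hσ : ContMDiff (𝓡 n) 𝓘(ℝ, ℝ) ∞ σ)
    (β : ∀ p : M, TangentSpace (𝓡 n) p →L[ℝ] ℝ) (hβ : FinslerCoord.IsSmoothOneForm β)
    (Lbar : TangentBundle (𝓡 n) M → ℝ)
    (hchange : Lbar = FinslerCoord.betaConformalChange σ β L)
    (hLbar : FinslerCoord.IsFinslerMetric Lbar)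
    (φ : OpenPartialHomeomorph M (FinslerCoord.Coord n))
    (hφ : φ ∈ IsManifold.maximalAtlas (𝓡 n) ∞ M)
    (x : FinslerCoord.Coord n) (hx : x ∈ φ.target) (y : FinslerCoord.Coord n) (hy : y ≠ 0) :
    let ℓ := FinslerCoord.coordRep φ L
    let ℓbar := FinslerCoord.coordRep φ Lbar
    let s : FinslerCoord.Coord n → ℝ := fun z => σ (φ.symm z)
    let b := FinslerCoord.formComp φ β
    (∀ r j : Fin n,
      FinslerCoord.cartanN ℓ r j x y = ∑ k, y k * FinslerCoord.Gam ℓ r j k x y ∧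
      FinslerCoord.cartanN ℓbar r j x y = ∑ k, y k * FinslerCoord.Gam ℓbar r j k x y) ∧
    (∀ r : Fin n, FinslerCoord.spray ℓbar r x y
        = FinslerCoord.spray ℓ r x y + FinslerCoord.diff00 ℓ ℓbar r x y) ∧
    (∀ r j : Fin n, FinslerCoord.cartanN ℓbar r j x y
        = FinslerCoord.cartanN ℓ r j x y + FinslerCoord.diff0 ℓ ℓbar r j x y) ∧
    (∀ r : Fin n, FinslerCoord.diff00 ℓ ℓbar r x y = FinslerCoord.D00 ℓ ℓbar s b r x y) ∧
    (∀ r j : Fin n, FinslerCoord.diff0 ℓ ℓbar r j x y = FinslerCoord.D0 ℓ ℓbar s b r j x y) := by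
  subst hchange
  have h := isLocalChange_coordRep hL hσ hβ hLbar hφ
  have hp : (x, y) ∈ FinslerCoord.slit φ.target := ⟨hx, hy⟩
  intro ℓ ℓbar s b
  refine ⟨fun r j => ⟨h.left.y_Gam hp r j, h.right.y_Gam hp r j⟩, fun r => ?_, fun r j => ?_,
    fun r => ?_, fun r j => ?_⟩
  · rw [h.left.diff00_eq h.right hp]; ring
  · rw [h.left.diff0_eq h.right hp]; ring
  · rw [h.left.diff00_eq h.right hp]; exact h.spray_diff hp r
  · rw [h.left.diff0_eq h.right hp]; exact h.cartanN_diff hp r j
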